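/- Theorem 5. Let $E$ be a reflexive real Banach space, let $X\subseteq E$ be sequentially weakly closed, and let $J,\Phi:X\to\mathbb{R}$ be two functions. Let $a,b\in[-\infty,+\infty]$ with $0\le a<b$. Assume that, for each real $\lambda\in\,]a,b[$, the function $J+\lambda\Phi$ is sequentially weakly lower semicontinuous on $X$, has (norm-)bounded sub-level sets $\{x\in X: J(x)+\lambda\Phi(x)\le\rho\}$ ($\rho\in\mathbb{R}$), and has a unique global minimum in $X$. Let $\hat M_a$ be the set of all global minima in $X$ of $J+a\Phi$ if $a>0$, and $\hat M_a=\emptyset$ if $a=0$. Let $\hat M_b$ be the set of all global minima in $X$ of $J+b\Phi$ if $b<+\infty$, and the set of all global minima in $X$ of $\Phi$ if $b=+\infty$. With the conventions $\inf\emptyset=+\infty$, $\sup\emptyset=-\infty$, put $$\gamma:=\max\Big\{\inf_X J,\ \sup_{\hat M_a}J\Big\},\qquad \delta:=\min\Big\{\sup_X J,\ \inf_{\hat M_b}J\Big\},$$ and assume that $\gamma<\delta$. Then, for each real $r\in\,]\gamma,\delta[$, the problem of minimizing $\Phi$ over $J^{-1}(r)$ is well-posed in the weak topology; that is, the restriction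 of $\Phi$ to $J^{-1}(r)$ has a unique global minimum $\tilde x_r$, and every sequence $(x_n)$ in $J^{-1}(r)$ with $\lim_{n\to\infty}\Phi(x_n)=\inf_{J^{-1}(r)}\Phi$ converges weakly to $\tilde x_r$. Moreover, the functions $r\mapsto\tilde x_r$ and $r\mapsto\Phi(\tilde x_r)$ are continuous in $]\gamma,\delta[$, the first one with respect to the weak topology. -/

import Mathlib

open Filter Topology

namespace ConstrainedMin

/-- The set of all global minima of a real-valued function. -/
def globalMinima {T : Type*} (f : T → ℝ) : Set T :=
  {x | ∀ y, f x ≤ f y}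

/-- The set of all global minima of the restriction of `f` to `C`. -/
def minimaOn {T : Type*} (f : T → ℝ) (C : Set T) : Set T :=
  {x | x ∈ C ∧ ∀ y ∈ C, f x ≤ f y}

/-- The problem of minimizing `f` over `C` is well-posed: `f` restricted to `C` has a unique global
minimum, and every minimizing sequence in `C` converges to it.  The infimum of `f` over `C` is taken
in the extended reals. -/
def IsWellPosed {T : Type*} [TopologicalSpace T] (f : T → ℝ) (C : Set T) : Prop :=
  ∃ xmin : T, minimaOn f C = {xmin} ∧
    ∀ u : ℕ → T, (∀ n, u n ∈ C) →
      Tendsto (fun n => (f (u n) : EReal)) atTop (𝓝 (⨅ x ∈ C, (f x : EReal))) →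
      Tendsto u atTop (𝓝 xmin)

/-- Sequential lower semicontinuity: `f x ≤ liminf f (u n)` whenever `u n → x`. -/
def SeqLowerSemicontinuous {T : Type*} [TopologicalSpace T] (f : T → ℝ) : Prop :=
  ∀ (u : ℕ → T) (x : T), Tendsto u atTop (𝓝 x) →
    (f x : EReal) ≤ liminf (fun n => (f (u n) : EReal)) atTop

/-- A real normed space is reflexive: the canonical map into the double dual is surjective. -/
def IsReflexive (E : Type*) [NormedAddCommGroup E] [NormedSpace ℝ E] : Prop :=
  Function.Surjective (NormedSpace.inclusionInDoubleDual ℝ E)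

/-- The sub-level sets `{x ∈ X : f x ≤ ρ}`, `ρ` real, are bounded in norm.  Here `X` is a subset of
`E`, seen as a subset of `E` with its weak topology. -/
def HasBoundedSublevelSets {E : Type*} [NormedAddCommGroup E] [NormedSpace ℝ E]
    {X : Set (WeakSpace ℝ E)} (f : X → ℝ) : Prop :=
  ∀ ρ : ℝ, Bornology.IsBounded {x : E | ∃ h : toWeakSpace ℝ E x ∈ X, f ⟨toWeakSpace ℝ E x, h⟩ ≤ ρ}

/-- For `0 ≤ a < +∞`: the global minima of `J + a Φ` if `a > 0`, and the empty set if `a = 0`. -/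
noncomputable def lowerMinima {T : Type*} (J Φ : T → ℝ) (a : EReal) : Set T :=
  {x | 0 < a ∧ x ∈ globalMinima (fun y => J y + a.toReal * Φ y)}

/-- For `0 < b ≤ +∞`: the global minima of `J + b Φ` if `b < +∞`, and those of `Φ` if `b = +∞`. -/
noncomputable def upperMinima {T : Type*} (J Φ : T → ℝ) (b : EReal) : Set T :=
  {x | (b < ⊤ ∧ x ∈ globalMinima (fun y => J y + b.toReal * Φ y)) ∨ (b = ⊤ ∧ x ∈ globalMinima Φ)}

/-- `γ = max {inf_X J, sup_{M_a} J}`, in the extended reals, with `sup ∅ = -∞`. -/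
noncomputable def gammaLevel {T : Type*} (J Φ : T → ℝ) (a : EReal) : EReal :=
  max (⨅ x, (J x : EReal)) (⨆ x ∈ lowerMinima J Φ a, (J x : EReal))

/-- `δ = min {sup_X J, inf_{M_b} J}`, in the extended reals, with `inf ∅ = +∞`. -/
noncomputable def deltaLevel {T : Type*} (J Φ : T → ℝ) (b : EReal) : EReal :=
  min (⨆ x, (J x : EReal)) (⨅ x ∈ upperMinima J Φ b, (J x : EReal))

end ConstrainedMin

/-! This is a Lagrange multiplier argument. For `l` in ]a,b[ let `xmin l` be the unique minimum of
`J + l Φ`. Since `l > 0`, on the level set of `J` through `xmin l` minimizing `Φ` is the same as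
minimizing `J + l Φ`; uniqueness and weak sequential compactness of sub-level sets then give
well-posedness (`isWellPosed`).

It remains to see that every `r` in ]γ,δ[ is some `J (xmin l)`. The map `l ↦ J (xmin l)` is
continuous, so otherwise its values all lie on one side of `r` (`exists_eq_of_not_forall`). Letting
`l` tend to `a` or to `b` then produces a minimum of the endpoint problem on the wrong side of `r`,
against the choice of γ and δ (`exists_eq_of_mem_Ioo`).

`J` and `Φ` need not be lower semicontinuous separately. Limits `K`, `L` of their values are
therefore tracked along with the limit point, and compared with its values through inequalities
affine in `l`. -/

namespace ConstrainedMin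

/-! ### Weak sequential compactness in reflexive spaces. -/

section WeakCompactness

variable {E : Type*} [NormedAddCommGroup E] [NormedSpace ℝ E]

/-- On a separable subspace, countably many continuous functionals separate points. -/
theorem exists_seq_dual_separating (F : Submodule ℝ E) [TopologicalSpace.SeparableSpace F] :
    ∃ f : ℕ → StrongDual ℝ E, ∀ y ∈ F, (∀ k, f k y = 0) → y = 0 := by
  choose f hf1 hf2 using fun k =>
    exists_dual_vector'' ℝ ((TopologicalSpace.denseSeq F k : F) : E)
  refine ⟨f, fun y hy h => ?_⟩
  by_contra hne
  have hpos : 0 < ‖y‖ := norm_pos_iff.mpr hne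
  obtain ⟨k, hk⟩ := (TopologicalSpace.denseRange_denseSeq F).exists_dist_lt (⟨y, hy⟩ : F)
    (half_pos hpos)
  set d : E := ((TopologicalSpace.denseSeq F k : F) : E) with hd
  have hk' : ‖y - d‖ < ‖y‖ / 2 := by simpa [dist_eq_norm] using hk
  -- `f k` has norm at most 1, norms `d` and kills `y`; so `d`, being close to `y`, would be too
  -- small.
  have h1 : ‖d‖ ≤ ‖y - d‖ := by
    have h2 : f k (d - y) = ‖d‖ := by
      rw [map_sub, h k, sub_zero]
      exact hf2 k
    have h3 := (f k).le_of_opNorm_le (hf1 k) (d - y)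
    rw [h2, one_mul, norm_sub_rev d y] at h3
    simpa using h3
  have h4 : ‖y‖ ≤ ‖y - d‖ + ‖d‖ := by simpa using norm_add_le (y - d) d
  linarith

/-- A functional on `E`, seen as a function on the weak space, is continuous. -/
theorem continuous_dual_weakSpace (f : StrongDual ℝ E) :
    Continuous fun x : WeakSpace ℝ E => f ((toWeakSpace ℝ E).symm x) :=
  WeakBilin.eval_continuous (topDualPairing ℝ E).flip f

/-- In a reflexive space, every bounded sequence has a weakly convergent subsequence. -/
theorem IsReflexive.exists_subseq_tendsto (hE : IsReflexive E) (u : ℕ → E)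
    (hu : Bornology.IsBounded (Set.range u)) :
    ∃ (x : WeakSpace ℝ E) (φ : ℕ → ℕ), StrictMono φ ∧
      Tendsto (fun n => toWeakSpace ℝ E (u (φ n))) atTop (𝓝 x) := by
  set S : Set (WeakSpace ℝ E) := toWeakSpace ℝ E '' Set.range u with hS
  have hK : IsCompact (closure S) := by
    apply NormedSpace.isCompact_closure_of_isBounded ℝ E S
    · rwa [hS, Set.preimage_image_eq _ (toWeakSpace ℝ E).injective]
    · intro z _
      obtain ⟨x, hx⟩ := hE (WeakDual.toStrongDual z)
      exact ⟨toWeakSpace ℝ E x, congrArg StrongDual.toWeakDual hx⟩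
  set F : Submodule ℝ E := (Submodule.span ℝ (Set.range u)).topologicalClosure with hF
  have hsep : TopologicalSpace.IsSeparable (F : Set E) := by
    rw [hF, Submodule.topologicalClosure_coe]
    exact ((Set.countable_range u).isSeparable.span (R := ℝ)).closure
  have : TopologicalSpace.SeparableSpace F := hsep.separableSpace
  obtain ⟨f, hf⟩ := exists_seq_dual_separating F
  -- Mazur: a subspace is convex, so its weak and norm closures agree.
  have hSF : closure S ⊆ toWeakSpace ℝ E '' (F : Set E) := by
    rw [hF, Submodule.topologicalClosure_coe,
      (Submodule.convex (Submodule.span ℝ (Set.range u))).toWeakSpace_closure ℝ]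
    exact closure_mono (Set.image_mono Submodule.subset_span)
  have : CompactSpace (closure S) := isCompact_iff_compactSpace.mp hK
  have : TopologicalSpace.MetrizableSpace (closure S) := by
    refine Metric.PiNatEmbed.TopologicalSpace.MetrizableSpace.of_countable_separating
      (fun n (k : closure S) => f n ((toWeakSpace ℝ E).symm k.1))
      (fun n => (continuous_dual_weakSpace (f n)).comp continuous_subtype_val) ?_
    intro p q hpq
    by_contra! hall
    apply hpq
    obtain ⟨x, hx, hxp⟩ := hSF p.2
    obtain ⟨y, hy, hyq⟩ := hSF q.2
    have : x - y = 0 := hf _ (F.sub_mem hx hy) fun k => by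
      have h := hall k
      rw [← hxp, ← hyq] at h
      simpa [sub_eq_zero] using h
    apply Subtype.ext
    rw [← hxp, ← hyq, sub_eq_zero.mp this]
  obtain ⟨x, φ, hφ, hlim⟩ := SeqCompactSpace.tendsto_subseq
    (fun n => (⟨toWeakSpace ℝ E (u n), subset_closure ⟨u n, ⟨n, rfl⟩, rfl⟩⟩ : closure S))
  exact ⟨x, φ, hφ, (continuous_subtype_val.tendsto x).comp hlim⟩

/-- In a reflexive space, a sequence in a bounded sub-level set of a function on a sequentially
weakly closed set has a weakly convergent subsequence. -/
theorem HasBoundedSublevelSets.exists_subseq_tendsto (hE : IsReflexive E)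
    {X : Set (WeakSpace ℝ E)} (hX : IsSeqClosed X) {f : X → ℝ} (hf : HasBoundedSublevelSets f)
    {ρ : ℝ} {u : ℕ → X} (hu : ∀ n, f (u n) ≤ ρ) :
    ∃ (x : X) (φ : ℕ → ℕ), StrictMono φ ∧ Tendsto (fun n => u (φ n)) atTop (𝓝 x) := by
  obtain ⟨x, φ, hφ, hlim⟩ := hE.exists_subseq_tendsto
    (fun n => (toWeakSpace ℝ E).symm (u n).1) ((hf ρ).subset (by
      rintro _ ⟨n, rfl⟩
      exact ⟨by simp, by simpa using hu n⟩))
  simp only [LinearEquiv.apply_symm_apply] at hlim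
  exact ⟨⟨x, hX (fun n => (u (φ n)).2) hlim⟩, φ, hφ, tendsto_subtype_rng.mpr hlim⟩

end WeakCompactness

end ConstrainedMin

/-! ### The curve of unconstrained minima: monotonicity and continuity. -/

namespace ConstrainedMin

variable {T : Type*} [TopologicalSpace T]

theorem SeqLowerSemicontinuous.le_of_tendsto {f : T → ℝ} (hf : SeqLowerSemicontinuous f)
    {u : ℕ → T} {x : T} {c : ℝ} (hu : Tendsto u atTop (𝓝 x))
    (hc : Tendsto (fun n => f (u n)) atTop (𝓝 c)) : f x ≤ c := by
  have h := hf u x hu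
  rw [(EReal.tendsto_coe.mpr hc).liminf_eq] at h
  exact EReal.coe_le_coe_iff.mp h

/-- The data of the minimization problems for `J + l Φ`, with `l` in a nonempty open interval `S` of
positive reals: sequential lower semicontinuity, sequential compactness of the sub-level sets, and
`xmin l` as the only global minimum. -/
structure UniqueMinFamily (J Φ : T → ℝ) (S : Set ℝ) (xmin : ℝ → T) : Prop where
  isOpen : IsOpen S
  ordConnected : S.OrdConnected
  nonempty : S.Nonempty
  pos : ∀ l ∈ S, 0 < l
  lsc : ∀ l ∈ S, SeqLowerSemicontinuous (fun x => J x + l * Φ x)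
  compact : ∀ l ∈ S, ∀ (ρ : ℝ) (u : ℕ → T), (∀ n, J (u n) + l * Φ (u n) ≤ ρ) →
    ∃ (x : T) (φ : ℕ → ℕ), StrictMono φ ∧ Tendsto (fun n => u (φ n)) atTop (𝓝 x)
  le : ∀ l ∈ S, ∀ y, J (xmin l) + l * Φ (xmin l) ≤ J y + l * Φ y
  unique : ∀ l ∈ S, ∀ x, (∀ y, J x + l * Φ x ≤ J y + l * Φ y) → x = xmin l

namespace UniqueMinFamily

variable {J Φ : T → ℝ} {S : Set ℝ} {xmin : ℝ → T}

theorem antitone_snd (h : UniqueMinFamily J Φ S xmin) {l m : ℝ} (hl : l ∈ S) (hm : m ∈ S)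
    (hlm : l ≤ m) : Φ (xmin m) ≤ Φ (xmin l) := by
  rcases hlm.eq_or_lt with rfl | hlt
  · rfl
  · have h1 := h.le l hl (xmin m)
    have h2 := h.le m hm (xmin l)
    by_contra! h3
    nlinarith [mul_pos (sub_pos.mpr hlt) (sub_pos.mpr h3)]

theorem monotone_fst (h : UniqueMinFamily J Φ S xmin) {l m : ℝ} (hl : l ∈ S) (hm : m ∈ S)
    (hlm : l ≤ m) : J (xmin l) ≤ J (xmin m) := by
  have h1 := h.le l hl (xmin m)
  have h2 := mul_le_mul_of_nonneg_left (h.antitone_snd hl hm hlm) (h.pos l hl).le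
  linarith

theorem tendsto_of_minimizing (h : UniqueMinFamily J Φ S xmin) {l : ℝ} (hl : l ∈ S) {u : ℕ → T}
    (hu : Tendsto (fun n => J (u n) + l * Φ (u n)) atTop (𝓝 (J (xmin l) + l * Φ (xmin l)))) :
    Tendsto u atTop (𝓝 (xmin l)) := by
  obtain ⟨ρ, hρ⟩ := hu.bddAbove_range
  refine tendsto_of_subseq_tendsto fun ns hns => ?_
  obtain ⟨x, φ, hφ, hlim⟩ := h.compact l hl ρ (fun n => u (ns n)) fun n => hρ ⟨ns n, rfl⟩
  have hx : J x + l * Φ x ≤ J (xmin l) + l * Φ (xmin l) :=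
    (h.lsc l hl).le_of_tendsto hlim (hu.comp (hns.comp hφ.tendsto_atTop))
  have hxl := h.unique l hl x fun y => hx.trans (h.le l hl y)
  exact ⟨φ, hxl ▸ hlim⟩

/-- A sequence along which `J` and `Φ` are bounded has a subsequence along which the points and both
functions converge; the limits satisfy the inequality coming from lower semicontinuity. -/
theorem exists_subseq_limits (h : UniqueMinFamily J Φ S xmin) {u : ℕ → T} {j₁ j₂ p₁ p₂ : ℝ}
    (hJ : ∀ n, J (u n) ∈ Set.Icc j₁ j₂) (hΦ : ∀ n, Φ (u n) ∈ Set.Icc p₁ p₂) :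
    ∃ (x : T) (K L : ℝ) (φ : ℕ → ℕ), StrictMono φ ∧
      Tendsto (fun n => u (φ n)) atTop (𝓝 x) ∧ Tendsto (fun n => J (u (φ n))) atTop (𝓝 K) ∧
      Tendsto (fun n => Φ (u (φ n))) atTop (𝓝 L) ∧
      ∀ l ∈ S, J x + l * Φ x ≤ K + l * L := by
  obtain ⟨m, hm⟩ := h.nonempty
  obtain ⟨x, φ, hφ, hx⟩ := h.compact m hm (j₂ + m * p₂) u fun n =>
    add_le_add (hJ n).2 (mul_le_mul_of_nonneg_left (hΦ n).2 (h.pos m hm).le)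
  obtain ⟨K, -, ψ, hψ, hK⟩ := isCompact_Icc.tendsto_subseq fun n => hJ (φ n)
  obtain ⟨L, -, θ, hθ, hL⟩ := isCompact_Icc.tendsto_subseq fun n => hΦ (φ (ψ n))
  have hx' := hx.comp (hψ.comp hθ).tendsto_atTop
  have hK' := hK.comp hθ.tendsto_atTop
  exact ⟨x, K, L, fun n => φ (ψ (θ n)), hφ.comp (hψ.comp hθ), hx', hK', hL, fun l hl =>
    (h.lsc l hl).le_of_tendsto hx' (hK'.add (hL.const_mul l))⟩

theorem add_mul_le_of_tendsto (h : UniqueMinFamily J Φ S xmin) {u : ℕ → ℝ} {l K L : ℝ}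
    (hu : ∀ n, u n ∈ S) (hl : Tendsto u atTop (𝓝 l))
    (hK : Tendsto (fun n => J (xmin (u n))) atTop (𝓝 K))
    (hL : Tendsto (fun n => Φ (xmin (u n))) atTop (𝓝 L)) (y : T) : K + l * L ≤ J y + l * Φ y :=
  le_of_tendsto_of_tendsto' (hK.add (hl.mul hL)) (tendsto_const_nhds.add (hl.mul_const _))
    fun n => h.le (u n) (hu n) y

/-- The values of `J` and `Φ` are included because convergence of the points alone does not control
them. -/
theorem continuousOn_prod (h : UniqueMinFamily J Φ S xmin) :
    ContinuousOn (fun l => (xmin l, J (xmin l), Φ (xmin l))) S := by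
  intro l hl
  refine tendsto_of_subseq_tendsto fun ns hns => ?_
  obtain ⟨ε, hε, hball⟩ := Metric.nhds_basis_closedBall.mem_iff.mp (h.isOpen.mem_nhds hl)
  rw [Real.closedBall_eq_Icc] at hball
  have h1 : l - ε ∈ S := hball ⟨le_rfl, by linarith⟩
  have h2 : l + ε ∈ S := hball ⟨by linarith, le_rfl⟩
  have hns' : Tendsto ns atTop (𝓝 l) := hns.mono_right nhdsWithin_le_nhds
  obtain ⟨N, hN⟩ := eventually_atTop.mp
    (hns'.eventually (Icc_mem_nhds (show l - ε < l by linarith) (show l < l + ε by linarith)))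
  have hI : ∀ n, ns (n + N) ∈ Set.Icc (l - ε) (l + ε) := fun n => hN _ (Nat.le_add_left _ _)
  have hS : ∀ n, ns (n + N) ∈ S := fun n => hball (hI n)
  obtain ⟨x, K, L, φ, hφ, hx, hK, hL, hle⟩ := h.exists_subseq_limits
    (u := fun n => xmin (ns (n + N)))
    (fun n => ⟨h.monotone_fst h1 (hS n) (hI n).1, h.monotone_fst (hS n) h2 (hI n).2⟩)
    (fun n => ⟨h.antitone_snd (hS n) h2 (hI n).2, h.antitone_snd h1 (hS n) (hI n).1⟩)
  have hlim : Tendsto (fun n => ns (φ n + N)) atTop (𝓝 l) :=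
    ((tendsto_add_atTop_iff_nat N).mpr hns').comp hφ.tendsto_atTop
  have hopt := h.add_mul_le_of_tendsto (fun n => hS (φ n)) hlim hK hL
  have hxl : x = xmin l := h.unique l hl x fun y => (hle l hl).trans (hopt y)
  have e0 := hopt x
  have e1 := hle _ h1
  have e2 := hle _ h2
  -- The affine functions `J x + t * Φ x` and `K + t * L` touch at `t = l` and are ordered at `l -
  -- ε` and `l + ε`, so their slopes agree.
  have hLx : L = Φ x := by
    apply le_antisymm <;> by_contra! hlt <;>
      nlinarith [mul_pos hε (sub_pos.mpr hlt)]
  have hKx : K = J x := by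
    have := hle l hl
    rw [hLx] at this e0
    linarith
  refine ⟨fun n => φ n + N, ?_⟩
  rw [hLx, hxl] at hL
  rw [hKx, hxl] at hK
  rw [hxl] at hx
  exact hx.prodMk_nhds (hK.prodMk_nhds hL)

theorem continuousOn_fst (h : UniqueMinFamily J Φ S xmin) :
    ContinuousOn (fun l => J (xmin l)) S :=
  (continuous_fst.comp continuous_snd).comp_continuousOn h.continuousOn_prod

/-! ### Limits at the endpoints of the parameter interval. -/

/-- If `J ≥ r` at all the minima `xmin l`, then `J + a Φ`, with `a = inf S`, has a global minimum
where `J ≥ r`. -/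
theorem exists_globalMinima_of_isGLB (h : UniqueMinFamily J Φ S xmin) {a r : ℝ} (ha0 : 0 ≤ a)
    (ha : IsGLB S a) (hr : ∀ l ∈ S, r ≤ J (xmin l)) {y : T} (hy : J y < r) :
    ∃ x, x ∈ globalMinima (fun x => J x + a * Φ x) ∧ r ≤ J x := by
  obtain ⟨u, hu, -, hua, huS⟩ := ha.exists_seq_antitone_tendsto h.nonempty
  obtain ⟨x, K, L, φ, hφ, hx, hK, hL, hle⟩ := h.exists_subseq_limits
    (u := fun n => xmin (u n)) (j₁ := r) (j₂ := J (xmin (u 0))) (p₁ := Φ (xmin (u 0))) (p₂ := Φ y)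
    (fun n => ⟨hr _ (huS n), h.monotone_fst (huS n) (huS 0) (hu (Nat.zero_le n))⟩)
    -- Comparison with `y`, where `J` is smaller, bounds `Φ` above even as the parameter tends to 0.
    (fun n => ⟨h.antitone_snd (huS n) (huS 0) (hu (Nat.zero_le n)), by
      have h1 := h.le _ (huS n) y
      have h2 := hr _ (huS n)
      have h3 := h.pos _ (huS n)
      exact le_of_mul_le_mul_left (by linarith) h3⟩)
  have hopt := h.add_mul_le_of_tendsto (fun n => huS (φ n)) (hua.comp hφ.tendsto_atTop) hK hL
  have hKr : r ≤ K := ge_of_tendsto' hK fun n => hr _ (huS (φ n))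
  have hax : J x + a * Φ x ≤ K + a * L :=
    le_of_tendsto_of_tendsto' (tendsto_const_nhds.add (hua.mul_const _))
      (tendsto_const_nhds.add (hua.mul_const _)) fun n => hle _ (huS n)
  refine ⟨x, fun z => hax.trans (hopt z), ?_⟩
  obtain ⟨l, hl⟩ := h.nonempty
  -- `S` is open, so it does not contain its infimum.
  have hal : a < l := by
    obtain ⟨l', hlt, hl'⟩ := Eventually.exists_lt (h.isOpen.mem_nhds hl)
    exact (ha.1 hl').trans_lt hlt
  have h1 := hle l hl
  have h2 := hopt x
  have h3 : Φ x ≤ L := by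
    by_contra! hlt
    nlinarith [mul_pos (sub_pos.mpr hal) (sub_pos.mpr hlt)]
  nlinarith [mul_nonneg ha0 (sub_nonneg.mpr h3)]

theorem exists_subseq_limits_of_monotone (h : UniqueMinFamily J Φ S xmin) {r : ℝ} {u : ℕ → ℝ}
    (hu : Monotone u) (huS : ∀ n, u n ∈ S) (hr : ∀ l ∈ S, J (xmin l) ≤ r) :
    ∃ (x : T) (K L : ℝ) (φ : ℕ → ℕ), StrictMono φ ∧
      Tendsto (fun n => J (xmin (u (φ n)))) atTop (𝓝 K) ∧
      Tendsto (fun n => Φ (xmin (u (φ n)))) atTop (𝓝 L) ∧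
      (∀ l ∈ S, J x + l * Φ x ≤ K + l * L) ∧ K ≤ r := by
  obtain ⟨x, K, L, φ, hφ, -, hK, hL, hle⟩ := h.exists_subseq_limits
    (u := fun n => xmin (u n)) (j₁ := J (xmin (u 0))) (j₂ := r)
    -- The lower bound on `Φ` comes from minimality at the fixed parameter `u 0` and `J ≤ r`.
    (p₁ := (J (xmin (u 0)) + u 0 * Φ (xmin (u 0)) - r) / u 0) (p₂ := Φ (xmin (u 0)))
    (fun n => ⟨h.monotone_fst (huS 0) (huS n) (hu (Nat.zero_le n)), hr _ (huS n)⟩)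
    (fun n => ⟨by
      have h1 := h.le _ (huS 0) (xmin (u n))
      have h2 := hr _ (huS n)
      rw [div_le_iff₀ (h.pos _ (huS 0))]
      linarith, h.antitone_snd (huS 0) (huS n) (hu (Nat.zero_le n))⟩)
  exact ⟨x, K, L, φ, hφ, hK, hL, hle, le_of_tendsto' hK fun n => hr _ (huS (φ n))⟩

/-- If `J ≤ r` at all the minima `xmin l`, then `J + b Φ`, with `b = sup S`, has a global minimum
where `J ≤ r`. -/
theorem exists_globalMinima_of_isLUB (h : UniqueMinFamily J Φ S xmin) {b r : ℝ}
    (hb : IsLUB S b) (hr : ∀ l ∈ S, J (xmin l) ≤ r) :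
    ∃ x, x ∈ globalMinima (fun x => J x + b * Φ x) ∧ J x ≤ r := by
  obtain ⟨u, hu, -, hub, huS⟩ := hb.exists_seq_monotone_tendsto h.nonempty
  obtain ⟨x, K, L, φ, hφ, hK, hL, hle, hKr⟩ := h.exists_subseq_limits_of_monotone hu huS hr
  have hopt := h.add_mul_le_of_tendsto (fun n => huS (φ n)) (hub.comp hφ.tendsto_atTop) hK hL
  have hbx : J x + b * Φ x ≤ K + b * L :=
    le_of_tendsto_of_tendsto' (tendsto_const_nhds.add (hub.mul_const _))
      (tendsto_const_nhds.add (hub.mul_const _)) fun n => hle _ (huS n)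
  refine ⟨x, fun z => hbx.trans (hopt z), ?_⟩
  obtain ⟨l, hl⟩ := h.nonempty
  have hlb : l < b := by
    obtain ⟨l', hlt, hl'⟩ := Eventually.exists_gt (h.isOpen.mem_nhds hl)
    exact hlt.trans_le (hb.1 hl')
  have h1 := hle l hl
  have h2 := hopt x
  have h3 : L ≤ Φ x := by
    by_contra! hlt
    nlinarith [mul_pos (sub_pos.mpr hlb) (sub_pos.mpr hlt)]
  have hb0 : 0 ≤ b := (h.pos l hl).le.trans hlb.le
  nlinarith [mul_nonneg hb0 (sub_nonneg.mpr h3)]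

/-- If `J ≤ r` at all the minima `xmin l` and `S` is unbounded above, then `Φ` has a global minimum
where `J ≤ r`. -/
theorem exists_globalMinima_of_unbounded (h : UniqueMinFamily J Φ S xmin) {r : ℝ}
    (hS : ¬ BddAbove S) (hr : ∀ l ∈ S, J (xmin l) ≤ r) :
    ∃ x, x ∈ globalMinima Φ ∧ J x ≤ r := by
  obtain ⟨l₀, hl₀⟩ := h.nonempty
  have huS : ∀ n : ℕ, l₀ + n ∈ S := fun n => by
    obtain ⟨m, hm, hlt⟩ := not_bddAbove_iff.mp hS (l₀ + n)
    exact h.ordConnected.out hl₀ hm ⟨by simp, hlt.le⟩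
  have hu : Monotone fun n : ℕ => l₀ + n := fun m n hmn => by simpa using hmn
  have hlim : Tendsto (fun n : ℕ => l₀ + (n : ℝ)) atTop atTop :=
    tendsto_atTop_add_const_left _ _ tendsto_natCast_atTop_atTop
  obtain ⟨x, K, L, φ, hφ, hK, hL, hle, hKr⟩ := h.exists_subseq_limits_of_monotone hu huS hr
  have hlimφ := hlim.comp hφ.tendsto_atTop
  -- Lower semicontinuity of `J + l Φ` is divided by `l`, and then `l → ∞`.
  have hxL : Φ x ≤ L := by
    have h1 : ∀ n : ℕ, (J x - K) * (l₀ + n)⁻¹ + Φ x ≤ L := fun n => by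
      have hp := h.pos _ (huS n)
      have := hle _ (huS n)
      rw [← le_sub_iff_add_le, ← div_eq_mul_inv, div_le_iff₀ hp]
      linarith
    have h2 := ((tendsto_inv_atTop_zero.comp hlim).const_mul (J x - K)).add_const (Φ x)
    rw [mul_zero, zero_add] at h2
    exact le_of_tendsto' h2 h1
  have hopt : ∀ y, L ≤ Φ y := fun y => by
    have h1 : ∀ n : ℕ, Φ (xmin (l₀ + φ n)) ≤
        (J y - J (xmin (l₀ + φ n))) * (l₀ + φ n)⁻¹ + Φ y := fun n => by
      have hp := h.pos _ (huS (φ n))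
      have := h.le _ (huS (φ n)) y
      rw [← sub_le_iff_le_add, ← div_eq_mul_inv, le_div_iff₀ hp]
      linarith
    have h2 := ((hK.const_sub (J y)).mul (tendsto_inv_atTop_zero.comp hlimφ)).add_const (Φ y)
    rw [mul_zero, zero_add] at h2
    exact le_of_tendsto_of_tendsto' hL h2 h1
  refine ⟨x, fun y => hxL.trans (hopt y), ?_⟩
  have h1 := hle l₀ hl₀
  have h2 := hopt x
  nlinarith [mul_nonneg (h.pos _ hl₀).le (sub_nonneg.mpr h2)]

theorem exists_eq_of_not_forall (h : UniqueMinFamily J Φ S xmin) {r : ℝ}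
    (h₁ : ¬ ∀ l ∈ S, r ≤ J (xmin l)) (h₂ : ¬ ∀ l ∈ S, J (xmin l) ≤ r) :
    ∃ l ∈ S, J (xmin l) = r := by
  push Not at h₁ h₂
  obtain ⟨l, hl, hlr⟩ := h₁
  obtain ⟨m, hm, hmr⟩ := h₂
  have := h.ordConnected.isPreconnected.intermediate_value hl hm h.continuousOn_fst
    ⟨hlr.le, hmr.le⟩
  simpa using this

/-! ### From unconstrained to constrained minima. -/

theorem minimaOn_eq (h : UniqueMinFamily J Φ S xmin) {l : ℝ} (hl : l ∈ S) :
    minimaOn Φ (J ⁻¹' {J (xmin l)}) = {xmin l} := by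
  have hp := h.pos l hl
  have hle : ∀ y, J y = J (xmin l) → Φ (xmin l) ≤ Φ y := fun y hy => by
    have := h.le l hl y
    rw [hy] at this
    exact le_of_mul_le_mul_left (by linarith) hp
  ext x
  constructor
  · rintro ⟨hx, hmin⟩
    refine h.unique l hl x fun y => le_trans ?_ (h.le l hl y)
    have h1 := hmin (xmin l) rfl
    rw [show J x = J (xmin l) from hx]
    have := mul_le_mul_of_nonneg_left h1 hp.le
    linarith
  · rintro rfl
    exact ⟨rfl, hle⟩

theorem isWellPosed (h : UniqueMinFamily J Φ S xmin) {l : ℝ} (hl : l ∈ S) :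
    IsWellPosed Φ (J ⁻¹' {J (xmin l)}) := by
  have hmem : xmin l ∈ minimaOn Φ (J ⁻¹' {J (xmin l)}) := by rw [h.minimaOn_eq hl]; rfl
  refine ⟨xmin l, h.minimaOn_eq hl, fun u hu hlim => h.tendsto_of_minimizing hl ?_⟩
  have hinf : (⨅ x ∈ J ⁻¹' {J (xmin l)}, (Φ x : EReal)) = (Φ (xmin l) : EReal) :=
    le_antisymm (iInf₂_le _ hmem.1)
      (le_iInf₂ fun y hy => EReal.coe_le_coe_iff.mpr (hmem.2 y hy))
  rw [hinf] at hlim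
  have hJ : ∀ n, J (u n) = J (xmin l) := hu
  simp only [hJ]
  exact tendsto_const_nhds.add ((EReal.tendsto_coe.mp hlim).const_mul l)

/-- The constrained minima and minimal values depend continuously on the level `r` in an open set of
levels attained by `J` at the minima `xmin l`. -/
theorem continuous_minimaOn (h : UniqueMinFamily J Φ S xmin) {R : Set ℝ} (hR : IsOpen R)
    (hatt : ∀ r ∈ R, ∃ l ∈ S, J (xmin l) = r) {xt : R → T}
    (hxt : ∀ r, xt r ∈ minimaOn Φ (J ⁻¹' {r.1})) :
    Continuous xt ∧ Continuous fun r => Φ (xt r) := by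
  choose! lam hlamS hlam using hatt
  have hxt_eq : ∀ l ∈ S, ∀ r : R, J (xmin l) = r → xt r = xmin l := fun l hl r hlr => by
    have := hxt r
    rw [← hlr, h.minimaOn_eq hl] at this
    exact this
  suffices hc : Continuous fun r => (xt r, Φ (xt r)) from
    ⟨continuous_fst.comp hc, continuous_snd.comp hc⟩
  refine continuous_iff_continuousAt.mpr fun r₀ => tendsto_of_subseq_tendsto fun ns hns => ?_
  obtain ⟨ε, hε, hball⟩ := Metric.nhds_basis_closedBall.mem_iff.mp (hR.mem_nhds r₀.2)
  rw [Real.closedBall_eq_Icc] at hball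
  have h1 : r₀.1 - ε ∈ R := hball ⟨le_rfl, by linarith⟩
  have h2 : r₀.1 + ε ∈ R := hball ⟨by linarith, le_rfl⟩
  have hns' : Tendsto (fun n => (ns n : ℝ)) atTop (𝓝 r₀.1) :=
    (continuous_subtype_val.tendsto r₀).comp hns
  -- Multipliers are merely chosen, so `lam` need not be continuous; monotonicity confines it to a
  -- compact interval inside `S`, which suffices to extract a limit.
  have hmono : ∀ r ∈ R, ∀ s ∈ R, r < s → lam r ≤ lam s := fun r hr s hs hrs => by
    by_contra! hlt
    have := h.monotone_fst (hlamS s hs) (hlamS r hr) hlt.le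
    rw [hlam r hr, hlam s hs] at this
    linarith
  have hev : ∀ᶠ n in atTop, lam (ns n) ∈ Set.Icc (lam (r₀.1 - ε)) (lam (r₀.1 + ε)) := by
    filter_upwards [hns'.eventually
      (Ioo_mem_nhds (show r₀.1 - ε < r₀.1 by linarith) (show r₀.1 < r₀.1 + ε by linarith))]
      with n hn
    exact ⟨hmono _ h1 _ (ns n).2 hn.1, hmono _ (ns n).2 _ h2 hn.2⟩
  obtain ⟨l, hlI, φ, hφ, hlim⟩ := isCompact_Icc.tendsto_subseq' hev.frequently
  have hl : l ∈ S := h.ordConnected.out (hlamS _ h1) (hlamS _ h2) hlI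
  have hlimS : Tendsto (fun n => lam (ns (φ n))) atTop (𝓝[S] l) :=
    tendsto_nhdsWithin_iff.mpr ⟨hlim, Eventually.of_forall fun n => hlamS _ (ns (φ n)).2⟩
  have hall := (h.continuousOn_prod l hl).tendsto.comp hlimS
  have hJl : J (xmin l) = r₀ := by
    refine tendsto_nhds_unique ((h.continuousOn_fst l hl).tendsto.comp hlimS) ?_
    refine (hns'.comp hφ.tendsto_atTop).congr fun n => (hlam _ (ns (φ n)).2).symm
  refine ⟨φ, ?_⟩
  have heq : ∀ n, xt (ns (φ n)) = xmin (lam (ns (φ n))) := fun n =>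
    hxt_eq _ (hlamS _ (ns (φ n)).2) _ (hlam _ (ns (φ n)).2)
  simp only [heq, hxt_eq l hl r₀ hJl]
  exact ((continuous_fst.prodMk (continuous_snd.comp continuous_snd)).tendsto _).comp hall

end UniqueMinFamily

end ConstrainedMin

/-! ### Every level between γ and δ is attained. -/

namespace ConstrainedMin

theorem isOpen_setOf_coe_mem_Ioo (a b : EReal) :
    IsOpen {l : ℝ | a < (l : EReal) ∧ (l : EReal) < b} :=
  isOpen_Ioo.preimage continuous_coe_real_ereal

variable {T : Type*} [TopologicalSpace T] {J Φ : T → ℝ} {xmin : ℝ → T} {a b : EReal}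

theorem UniqueMinFamily.exists_eq_of_mem_Ioo
    (h : UniqueMinFamily J Φ {l : ℝ | a < (l : EReal) ∧ (l : EReal) < b} xmin)
    (ha : 0 ≤ a) (hab : a < b) {r : ℝ} (hγ : gammaLevel J Φ a < (r : EReal))
    (hδ : (r : EReal) < deltaLevel J Φ b) :
    ∃ l ∈ {l : ℝ | a < (l : EReal) ∧ (l : EReal) < b}, J (xmin l) = r := by
  apply h.exists_eq_of_not_forall
  · intro hr
    lift a to ℝ using ⟨hab.ne_top, (EReal.bot_lt_zero.trans_le ha).ne'⟩
    have ha' : 0 ≤ a := by exact_mod_cast ha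
    obtain ⟨y, hy⟩ := iInf_lt_iff.mp ((le_max_left _ _).trans_lt hγ)
    have hy' : J y < r := EReal.coe_lt_coe_iff.mp hy
    have hglb : IsGLB {l : ℝ | (a : EReal) < (l : EReal) ∧ (l : EReal) < b} a := by
      refine ⟨fun l hl => (EReal.coe_lt_coe_iff.mp hl.1).le, fun c hc => ?_⟩
      by_contra! hac
      obtain ⟨l, hal, hlm⟩ := EReal.lt_iff_exists_real_btwn.mp
        (lt_min hab (EReal.coe_lt_coe_iff.mpr hac))
      have := hc (show l ∈ _ from ⟨hal, hlm.trans_le (min_le_left _ _)⟩)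
      exact absurd (EReal.coe_lt_coe_iff.mp (hlm.trans_le (min_le_right _ _))) this.not_gt
    obtain ⟨x, hx, hxr⟩ := h.exists_globalMinima_of_isGLB ha' hglb hr hy'
    -- For `a = 0` the limit point would minimize `J` itself, yet `J y < r`; for `a > 0` it lies in
    -- `lowerMinima`.
    rcases ha'.eq_or_lt with rfl | hpos
    · have := hx y
      simp only [zero_mul, add_zero] at this
      linarith
    · have hmem : x ∈ lowerMinima J Φ (a : EReal) := ⟨by exact_mod_cast hpos, hx⟩
      have h1 : (J x : EReal) ≤ gammaLevel J Φ a :=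
        (le_iSup₂ (f := fun x (_ : x ∈ lowerMinima J Φ (a : EReal)) => (J x : EReal))
          x hmem).trans (le_max_right _ _)
      exact absurd (EReal.coe_lt_coe_iff.mp (h1.trans_lt hγ)) hxr.not_gt
  · intro hr
    suffices hx : ∃ x ∈ upperMinima J Φ b, J x ≤ r by
      obtain ⟨x, hx, hxr⟩ := hx
      have h1 : deltaLevel J Φ b ≤ (J x : EReal) :=
        (min_le_right _ _).trans (iInf₂_le x hx)
      exact absurd (EReal.coe_lt_coe_iff.mp (hδ.trans_le h1)) hxr.not_gt
    rcases eq_or_ne b ⊤ with rfl | hb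
    · obtain ⟨x, hx, hxr⟩ := h.exists_globalMinima_of_unbounded (by
        rintro ⟨c, hc⟩
        obtain ⟨l, hl, -⟩ := EReal.lt_iff_exists_real_btwn.mp
          (max_lt hab (EReal.coe_lt_top c))
        have := hc (show l ∈ _ from ⟨(le_max_left _ _).trans_lt hl, EReal.coe_lt_top l⟩)
        exact absurd (EReal.coe_lt_coe_iff.mp ((le_max_right _ _).trans_lt hl)) this.not_gt) hr
      exact ⟨x, Or.inr ⟨rfl, hx⟩, hxr⟩
    · lift b to ℝ using ⟨hb, hab.ne_bot⟩
      have hlub : IsLUB {l : ℝ | a < (l : EReal) ∧ (l : EReal) < b} b := by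
        refine ⟨fun l hl => (EReal.coe_lt_coe_iff.mp hl.2).le, fun c hc => ?_⟩
        by_contra! hcb
        obtain ⟨l, hml, hlb⟩ := EReal.lt_iff_exists_real_btwn.mp
          (max_lt hab (EReal.coe_lt_coe_iff.mpr hcb))
        have := hc (show l ∈ _ from ⟨(le_max_left _ _).trans_lt hml, hlb⟩)
        exact absurd (EReal.coe_lt_coe_iff.mp ((le_max_right _ _).trans_lt hml)) this.not_gt
      obtain ⟨x, hx, hxr⟩ := h.exists_globalMinima_of_isLUB hlub hr
      exact ⟨x, Or.inl ⟨EReal.coe_lt_top b, hx⟩, hxr⟩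

end ConstrainedMin

theorem theorem5 {E : Type*} [NormedAddCommGroup E] [NormedSpace ℝ E] [CompleteSpace E]
    (hE : ConstrainedMin.IsReflexive E)
    (X : Set (WeakSpace ℝ E)) (hX : IsSeqClosed X)
    (J Φ : X → ℝ) (a b : EReal) (ha : 0 ≤ a) (hab : a < b)
    (hlsc : ∀ l : ℝ, a < (l : EReal) → (l : EReal) < b →
      ConstrainedMin.SeqLowerSemicontinuous (fun x => J x + l * Φ x))
    (hbdd : ∀ l : ℝ, a < (l : EReal) → (l : EReal) < b →
      ConstrainedMin.HasBoundedSublevelSets (fun x => J x + l * Φ x))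
    (hmin : ∀ l : ℝ, a < (l : EReal) → (l : EReal) < b →
      ∃! x, x ∈ ConstrainedMin.globalMinima (fun x => J x + l * Φ x))
    (hγδ : ConstrainedMin.gammaLevel J Φ a < ConstrainedMin.deltaLevel J Φ b) :
    (∀ r : ℝ, ConstrainedMin.gammaLevel J Φ a < (r : EReal) →
      (r : EReal) < ConstrainedMin.deltaLevel J Φ b →
      ConstrainedMin.IsWellPosed Φ (J ⁻¹' {r})) ∧
    ∀ xt : {r : ℝ | ConstrainedMin.gammaLevel J Φ a < (r : EReal) ∧
        (r : EReal) < ConstrainedMin.deltaLevel J Φ b} → X,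
      (∀ r, xt r ∈ ConstrainedMin.minimaOn Φ (J ⁻¹' {r.1})) →
      Continuous xt ∧ Continuous (fun r => Φ (xt r)) := by

  obtain ⟨l₀, hl₀⟩ := EReal.lt_iff_exists_real_btwn.mp hab
  obtain ⟨x₀, -⟩ := hmin l₀ hl₀.1 hl₀.2
  have hex : ∀ l : ℝ, ∃ x, a < (l : EReal) ∧ (l : EReal) < b →
      x ∈ ConstrainedMin.globalMinima (fun x => J x + l * Φ x) ∧
      ∀ z, z ∈ ConstrainedMin.globalMinima (fun x => J x + l * Φ x) → z = x := fun l => by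
    by_cases hl : a < (l : EReal) ∧ (l : EReal) < b
    · obtain ⟨x, hx⟩ := hmin l hl.1 hl.2
      exact ⟨x, fun _ => hx⟩
    · exact ⟨x₀, fun h => absurd h hl⟩
  choose xmin hxmin using hex
  have h : ConstrainedMin.UniqueMinFamily J Φ
      {l : ℝ | a < (l : EReal) ∧ (l : EReal) < b} xmin :=
    { isOpen := ConstrainedMin.isOpen_setOf_coe_mem_Ioo a b
      ordConnected := ⟨fun l hl m hm k hk =>
        ⟨hl.1.trans_le (EReal.coe_le_coe_iff.mpr hk.1),
          (EReal.coe_le_coe_iff.mpr hk.2).trans_lt hm.2⟩⟩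
      nonempty := ⟨l₀, hl₀⟩
      pos := fun l hl => by exact_mod_cast ha.trans_lt hl.1
      lsc := fun l hl => hlsc l hl.1 hl.2
      compact := fun l hl ρ u hu =>
        (hbdd l hl.1 hl.2).exists_subseq_tendsto hE hX hu
      le := fun l hl => (hxmin l hl).1
      unique := fun l hl => (hxmin l hl).2 }
  refine ⟨fun r hγ hδ => ?_, fun xt hxt => ?_⟩
  · obtain ⟨l, hl, rfl⟩ := h.exists_eq_of_mem_Ioo ha hab hγ hδ
    exact h.isWellPosed hl
  · exact h.continuous_minimaOn (ConstrainedMin.isOpen_setOf_coe_mem_Ioo _ _)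
      (fun r hr => h.exists_eq_of_mem_Ioo ha hab hr.1 hr.2) hxt
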